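/- Let $n\ge 1$ and write points of $\mathbb{R}^{n+1}$ as $\overline{x}=(x,t)$, with spatial variable $x=(x_1,\dots,x_n)\in\mathbb{R}^n$ and time variable $t\in\mathbb{R}$. Let $$P(\overline{x})=\frac{t}{|\overline{x}|^{n+1}}\ \text{ if } t>0,\qquad P(\overline{x})=0\ \text{ if } t\le 0,$$ and let $P^{*}(\overline{x})=P(-\overline{x})$. For a compactly supported distribution $T$ on $\mathbb{R}^{n+1}$, $P*T$ denotes the distribution $\langle P*T,\varphi\rangle=\langle T,P^{*}*\varphi\rangle$, $\varphi\in C_c^\infty(\mathbb{R}^{n+1})$, and $\|P*T\|_\infty\le 1$ means that $P*T$ is given by a function in $L^\infty(\mathbb{R}^{n+1})$ of norm at most $1$. For a compact set $E\subset\mathbb{R}^{n+1}$, the $1/2$-caloric capacity of $E$ is $$\gamma(E)=\sup|\langle T,1\rangle|,$$ where the supremum is taken over all distributions $T$ on $\mathbb{R}^{n+1}$ with $\operatorname{supp}T\subset E$ such that $\|P*T\|_\infty\le 1$ and such that $|\langle T,\varphi\rangle|\le \ell(Q)^n$ for every cube $Q$ with sides parallel to the coordinate axes and side length $\ell(Q)>0$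 and every $\varphi\in C_c^\infty(\mathbb{R}^{n+1})$ supported on $Q$ with $\|\nabla\varphi\|_\infty\le \ell(Q)^{-1}$. Lemma 6.2. Let $E\subset\mathbb{R}^{n+1}$ be a compact set contained in an affine hyperplane of the form $\{x_i=a\}$, for some $a\in\mathbb{R}$ and some $i\in\{1,\dots,n\}$. Then $\gamma(E)=0$. -/

import Mathlib

open MeasureTheory Set Topology Distributions
open scoped ContDiff

noncomputable section

namespace HalfCaloric

/-- The ambient space `ℝ^{n+1}` with its Euclidean norm. The first `n` coordinates are the spatial
variables `x_1, …, x_n` (the indices `i.castSucc`, `i : Fin n`); the last one, of index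
`Fin.last n`, is the time variable `t`. -/
abbrev SpaceTime (n : ℕ) : Type := EuclideanSpace ℝ (Fin (n + 1))

/-- The fundamental solution `P(x,t) = t / |(x,t)|^{n+1}` for `t > 0`, and `0` for `t ≤ 0`, of the
`1/2`-heat operator `(-Δ_x)^{1/2} + ∂_t`, up to a positive dimensional constant. -/
def P (n : ℕ) (z : SpaceTime n) : ℝ :=
  if 0 < z (Fin.last n) then z (Fin.last n) / ‖z‖ ^ (n + 1) else 0

/-- The conjugate kernel `P^*(z) = P(-z)`. -/
def Pstar (n : ℕ) (z : SpaceTime n) : ℝ := P n (-z)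

/-- Real test functions on `ℝ^{n+1}`: smooth functions with compact support. -/
abbrev Test (n : ℕ) : Type := 𝓓((⊤ : TopologicalSpace.Opens (SpaceTime n)), ℝ)

/-- Real distributions on `ℝ^{n+1}`. Their support is `Distribution.dsupport`. -/
abbrev Distr (n : ℕ) : Type := 𝓓'((⊤ : TopologicalSpace.Opens (SpaceTime n)), ℝ)

/-- The pairing `⟨T, f⟩` of a compactly supported distribution `T` with a smooth function `f` whose
support need not be compact: it is `T ψ` for any test function `ψ` that coincides with `f` on a
neighbourhood of the support of `T`. That such a `ψ` exists, and that the value does not depend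
on it, is proved in `exists_test_eq` and `pair_eq`. -/
def pair {n : ℕ} (T : Distr n) (f : SpaceTime n → ℝ) : ℝ :=
  open Classical in
  if h : ∃ ψ : Test n, ∀ᶠ z in 𝓝ˢ (Distribution.dsupport T), ψ z = f z then T h.choose else 0

/-- The distribution `P * T`, for `T` compactly supported: it acts on a test function `φ` by
`⟨P * T, φ⟩ = ⟨T, P^* * φ⟩`, where `P^* * φ` is a smooth function. -/
def potential {n : ℕ} (T : Distr n) (φ : Test n) : ℝ :=
  pair T (convolution (Pstar n) φ (ContinuousLinearMap.lsmul ℝ ℝ) volume)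

/-- `‖P * T‖_∞ ≤ 1`: the distribution `P * T` is given by a function `g ∈ L^∞(ℝ^{n+1})` of norm
at most `1`. -/
def PotentialBoundedByOne {n : ℕ} (T : Distr n) : Prop :=
  ∃ g : SpaceTime n → ℝ, AEStronglyMeasurable g volume ∧ eLpNorm g ⊤ volume ≤ 1 ∧
    ∀ φ : Test n, potential T φ = ∫ z, g z * φ z

/-- The closed cube with sides parallel to the axes, of centre `c` and side length `l`. -/
def cube {n : ℕ} (c : SpaceTime n) (l : ℝ) : Set (SpaceTime n) :=
  {z | ∀ j, |z j - c j| ≤ l / 2}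

/-- `T` has `n`-growth with constant `1`: `|⟨T, φ⟩| ≤ ℓ(Q)^n` for every cube `Q` and every test
function `φ` supported on `Q` with `‖∇φ‖_∞ ≤ ℓ(Q)⁻¹` (gradient in all of the variables). -/
def HasGrowthOne {n : ℕ} (T : Distr n) : Prop :=
  ∀ (c : SpaceTime n) (l : ℝ), 0 < l → ∀ φ : Test n, tsupport φ ⊆ cube c l →
    (∀ z, ‖gradient φ z‖ ≤ l⁻¹) → |T φ| ≤ l ^ n

/-- The distributions admissible for the `1/2`-caloric capacity of the compact set `E`. -/
structure Admissible {n : ℕ} (E : Set (SpaceTime n)) (T : Distr n) : Prop where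
  support_subset : Distribution.dsupport T ⊆ E
  growth : HasGrowthOne T
  potential_le_one : PotentialBoundedByOne T

/-- The `1/2`-caloric capacity `γ(E) = sup |⟨T, 1⟩|` of a compact set `E ⊆ ℝ^{n+1}`, the supremum
over the admissible distributions, as an element of `[0, ∞]`. -/
def gamma {n : ℕ} (E : Set (SpaceTime n)) : ENNReal :=
  ⨆ (T : Distr n) (_ : Admissible E T), ENNReal.ofReal |pair T (fun _ => 1)|

/-! ### The pairing and the potential are well defined -/

/-- The product of a smooth function and a test function, as a test function. -/
def smulTest {n : ℕ} (f : SpaceTime n → ℝ) (hf : ContDiff ℝ ∞ f) (φ : Test n) : Test n where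
  toFun z := f z * φ z
  contDiff' := hf.mul φ.contDiff
  hasCompactSupport' := φ.hasCompactSupport.mul_left
  tsupport_subset' := by simp

/-- A distribution vanishes on the complement of its support. -/
theorem apply_eq_zero_of_disjoint {n : ℕ} (T : Distr n) (φ : Test n)
    (h : Disjoint (tsupport φ) (Distribution.dsupport T)) : T φ = 0 := by
  have hc : ∀ x ∈ tsupport φ, ∃ s : Set (SpaceTime n),
      Distribution.IsVanishingOn T s ∧ IsOpen s ∧ x ∈ s := fun x hx =>
    (Distribution.notMem_dsupport_iff x).1 (Set.disjoint_left.1 h hx)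
  choose! U hU hUo hxU using hc
  obtain ⟨t, ht, hcov⟩ := φ.hasCompactSupport.isCompact.elim_nhds_subcover U
    (fun x hx => (hUo x hx).mem_nhds (hxU x hx))
  obtain ⟨ρ, hρ⟩ := SmoothPartitionOfUnity.exists_isSubordinate (modelWithCornersSelf ℝ (SpaceTime n))
    (isClosed_tsupport φ) (fun x : t => U x) (fun x => hUo x (ht x x.2))
    (by simpa [Set.iUnion_subtype] using hcov)
  have hsum : φ = ∑ x : t, smulTest (ρ x) (ρ x).contMDiff.contDiff φ := by
    ext z
    have h1 : (∑ x : t, smulTest (ρ x) (ρ x).contMDiff.contDiff φ : Test n) z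
        = ∑ x : t, ρ x z * φ z := by
      simp [smulTest]
    rw [h1, ← Finset.sum_mul]
    by_cases hz : z ∈ tsupport φ
    · have := ρ.sum_eq_one hz
      rw [finsum_eq_sum_of_fintype] at this
      rw [this, one_mul]
    · rw [image_eq_zero_of_notMem_tsupport hz, mul_zero]
  rw [hsum, map_sum]
  refine Finset.sum_eq_zero fun x _ => hU x (ht x x.2) _ ?_
  exact (tsupport_mul_subset_left (f := ρ x) (g := φ)).trans (hρ x)

/-- The value of `pair T f` does not depend on the test function used to compute it. -/
theorem pair_eq {n : ℕ} (T : Distr n) (f : SpaceTime n → ℝ) (ψ : Test n)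
    (hψ : ∀ᶠ z in 𝓝ˢ (Distribution.dsupport T), ψ z = f z) : pair T f = T ψ := by
  have h : ∃ ψ : Test n, ∀ᶠ z in 𝓝ˢ (Distribution.dsupport T), ψ z = f z := ⟨ψ, hψ⟩
  rw [pair, dif_pos h, ← sub_eq_zero, ← map_sub]
  refine apply_eq_zero_of_disjoint T _ (Set.disjoint_right.2 fun z hz => ?_)
  rw [notMem_tsupport_iff_eventuallyEq]
  filter_upwards [nhds_le_nhdsSet hz (h.choose_spec.and hψ)] with w hw
  simp [hw.1, hw.2]

/-- A smooth function coincides with a test function near any compact set. -/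
theorem exists_test_eq {n : ℕ} {K : Set (SpaceTime n)} (hK : IsCompact K) {f : SpaceTime n → ℝ}
    (hf : ContDiff ℝ ∞ f) : ∃ ψ : Test n, ∀ᶠ z in 𝓝ˢ K, ψ z = f z := by
  obtain ⟨L, hL, hKL⟩ := exists_compact_superset hK
  obtain ⟨χ, h1, h0, -⟩ := exists_contMDiffMap_one_nhds_of_subset_interior (n := (⊤ : ℕ∞))
    (modelWithCornersSelf ℝ (SpaceTime n)) hK.isClosed hKL
  have hχ : HasCompactSupport χ := HasCompactSupport.intro hL h0
  refine ⟨⟨fun z => f z * χ z, hf.mul χ.contMDiff.contDiff, hχ.mul_left, by simp⟩, ?_⟩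
  filter_upwards [h1] with z hz
  change f z * χ z = f z
  rw [hz, mul_one]

theorem locallyIntegrable_Pstar (n : ℕ) : LocallyIntegrable (Pstar n) volume := by
  have hm : Measurable (Pstar n) := by
    have : Measurable (P n) := by
      unfold P
      refine Measurable.ite (measurableSet_lt measurable_const (by fun_prop)) ?_ measurable_const
      fun_prop
    exact this.comp measurable_neg
  refine locallyIntegrable_of_norm_le_rpow (C := 1) (α := n) (by simp) (by simp)
    (Filter.Eventually.of_forall fun z => ?_) hm.aestronglyMeasurable
  have hz : |z (Fin.last n)| ≤ ‖z‖ := by simpa using PiLp.norm_apply_le z (Fin.last n)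
  rw [Real.rpow_neg (norm_nonneg _), Real.rpow_natCast, one_mul, Pstar, P, norm_neg]
  split_ifs with h
  · have h0 : 0 < ‖z‖ := lt_of_lt_of_le (abs_pos.2 (by
      intro h'; simp [h'] at h)) hz
    rw [Real.norm_eq_abs, abs_div, abs_of_pos (pow_pos h0 _), div_le_iff₀ (pow_pos h0 _), pow_succ,
      inv_mul_cancel_left₀ (pow_pos h0 n).ne']
    simpa using hz
  · simp

/-- `P^* * φ` is smooth for every test function `φ`. -/
theorem contDiff_Pstar_convolution {n : ℕ} (φ : Test n) :
    ContDiff ℝ ∞ (convolution (Pstar n) φ (ContinuousLinearMap.lsmul ℝ ℝ) volume) :=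
  φ.hasCompactSupport.contDiff_convolution_right _ (locallyIntegrable_Pstar n) φ.contDiff

end HalfCaloric

end

noncomputable section

namespace HalfCaloric

/-! The growth condition makes `T` behave like a finite measure on `E`, and the kernel is not
integrable along a spatial hyperplane.

Growth: a bounded piece of a hyperplane meets `O(m ^ n)` cells of mesh `1 / m`. Splitting `φ` by a
partition of unity, each cell contributes `O(m ^ (-n))` times `sup |φ|` over `E`, plus an error that
vanishes as `m → ∞`. Hence `|T φ| ≤ K * sup_E |φ|` (`HasGrowthOne.exists_abs_apply_le`).

Kernel: restricted to `x_i = 0`, `P` is homogeneous of degree `-n` in `n` variables, so its integral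
diverges logarithmically at the origin. Test `P * T` against a function `φ` of bounded mass that
concentrates on `x_i = a` at width `2 ^ (-N)` (`exists_concentrated_test`). On `E`, `P^* * φ`
differs from a constant `I` by at most the mass of `φ` (`abs_convolution_sub_le`), and `I ≥ c * N`
(`exists_mul_le_setIntegral_Pstar`). The bound on `P * T` controls `⟨T, P^* * φ⟩`, and order zero
controls `⟨T, P^* * φ - I⟩`. So `I * |⟨T, 1⟩|` stays bounded as `N → ∞`, which forces `⟨T, 1⟩ = 0`.
-/

/-! ### Coordinate bounds and rescaled growth. -/

theorem norm_le_of_forall_abs_le {n : ℕ} {r : ℝ} (hr : 0 ≤ r) {z : SpaceTime n}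
    (h : ∀ j, |z j| ≤ r) : ‖z‖ ≤ √(n + 1) * r := by
  rw [EuclideanSpace.norm_eq, ← Real.sqrt_sq hr, ← Real.sqrt_mul (by positivity)]
  refine Real.sqrt_le_sqrt ?_
  calc ∑ j, ‖z j‖ ^ 2 ≤ ∑ _j : Fin (n + 1), r ^ 2 :=
        Finset.sum_le_sum fun j _ => by
          rw [Real.norm_eq_abs]
          exact pow_le_pow_left₀ (abs_nonneg _) (h j) 2
    _ = (n + 1) * r ^ 2 := by simp

theorem abs_coord_le_norm {n : ℕ} (z : SpaceTime n) (j : Fin (n + 1)) : |z j| ≤ ‖z‖ := by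
  simpa using PiLp.norm_apply_le z j

/-- The growth condition, rescaled to an arbitrary bound on the derivative. -/
theorem HasGrowthOne.abs_apply_le {n : ℕ} {T : Distr n} (hT : HasGrowthOne T) {c : SpaceTime n}
    {l G : ℝ} (hl : 0 < l) (hG : 0 < G) (φ : Test n) (hs : tsupport φ ⊆ cube c l)
    (hφ : ∀ z, ‖fderiv ℝ φ z‖ ≤ G) : |T φ| ≤ G * l * l ^ n := by
  have hGl : 0 < G * l := mul_pos hG hl
  have hcoe : (((G * l)⁻¹ • φ : Test n) : SpaceTime n → ℝ) = fun z => (G * l)⁻¹ • φ z := by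
    ext z; simp
  have key := hT c l hl ((G * l)⁻¹ • φ) ?_ ?_
  · rw [map_smul, smul_eq_mul, abs_mul, abs_of_pos (inv_pos.2 hGl),
      inv_mul_le_iff₀ hGl] at key
    exact key
  · rw [hcoe]
    exact (tsupport_smul_subset_right (fun _ => (G * l)⁻¹) φ).trans hs
  · intro z
    rw [gradient, LinearIsometryEquiv.norm_map, hcoe, fderiv_fun_const_smul
      (φ.contDiff.differentiable (by simp) z), norm_smul, Real.norm_of_nonneg (by positivity)]
    calc (G * l)⁻¹ * ‖fderiv ℝ φ z‖ ≤ (G * l)⁻¹ * G := by gcongr; exact hφ z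
      _ = l⁻¹ := by field_simp

/-! ### A smooth partition of unity on a lattice. -/

/-- A smooth function supported in `[-1, 1]` whose integer translates add up to `1`. -/
def hat (x : ℝ) : ℝ := Real.smoothTransition (x + 1) - Real.smoothTransition x

theorem hat_contDiff : ContDiff ℝ ∞ hat :=
  (Real.smoothTransition.contDiff.comp (contDiff_id.add contDiff_const)).sub
    Real.smoothTransition.contDiff

theorem abs_hat_le_one (x : ℝ) : |hat x| ≤ 1 := by
  have h1 := Real.smoothTransition.nonneg (x + 1)
  have h2 := Real.smoothTransition.le_one (x + 1)
  have h3 := Real.smoothTransition.nonneg x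
  have h4 := Real.smoothTransition.le_one x
  rw [abs_le, hat]
  constructor <;> linarith

theorem hat_eq_zero {x : ℝ} (hx : 1 ≤ |x|) : hat x = 0 := by
  rw [hat]
  rcases le_abs'.1 hx with h | h
  · rw [Real.smoothTransition.zero_of_nonpos (by linarith),
      Real.smoothTransition.zero_of_nonpos (by linarith), sub_self]
  · rw [Real.smoothTransition.one_of_one_le (by linarith),
      Real.smoothTransition.one_of_one_le h, sub_self]

/-- `hat` is a difference of consecutive translates of one function, so only the two end terms
survive. -/
theorem sum_hat_telescope (N : ℕ) (x : ℝ) :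
    ∑ k ∈ Finset.Icc (-(N : ℤ)) N, hat (x - k)
      = Real.smoothTransition (x + N + 1) - Real.smoothTransition (x - N) := by
  induction N with
  | zero => simp [hat]
  | succ N ih =>
    have hI : Finset.Icc (-((N + 1 : ℕ) : ℤ)) ((N + 1 : ℕ) : ℤ)
        = insert (-((N : ℤ) + 1)) (insert ((N : ℤ) + 1) (Finset.Icc (-(N : ℤ)) N)) := by
      ext k
      simp only [Finset.mem_Icc, Finset.mem_insert]
      omega
    rw [hI, Finset.sum_insert (by simp; omega), Finset.sum_insert (by simp), ih, hat, hat]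
    push_cast
    rw [show x - -((N : ℝ) + 1) + 1 = x + (N + 1) + 1 by ring,
      show x - -((N : ℝ) + 1) = x + N + 1 by ring,
      show x - ((N : ℝ) + 1) + 1 = x - N by ring]
    ring

theorem sum_hat {N : ℕ} {x : ℝ} (hx : |x| ≤ N) :
    ∑ k ∈ Finset.Icc (-(N : ℤ)) N, hat (x - k) = 1 := by
  rw [abs_le] at hx
  rw [sum_hat_telescope, Real.smoothTransition.one_of_one_le (by linarith),
    Real.smoothTransition.zero_of_nonpos (by linarith), sub_zero]

/-- A smooth function supported in `[-1, 1]^{n+1}` whose integer translates add up to `1`. -/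
def latticeBump {n : ℕ} (z : SpaceTime n) : ℝ := ∏ j, hat (z j)

theorem latticeBump_contDiff (n : ℕ) : ContDiff ℝ ∞ (latticeBump (n := n)) := by
  unfold latticeBump
  refine contDiff_prod fun j _ => hat_contDiff.comp ?_
  fun_prop

theorem abs_latticeBump_le_one {n : ℕ} (z : SpaceTime n) : |latticeBump z| ≤ 1 := by
  rw [latticeBump, Finset.abs_prod]
  exact Finset.prod_le_one (fun _ _ => abs_nonneg _) fun _ _ => abs_hat_le_one _

theorem latticeBump_eq_zero {n : ℕ} {z : SpaceTime n} {j : Fin (n + 1)} (h : 1 ≤ |z j|) :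
    latticeBump z = 0 :=
  Finset.prod_eq_zero (Finset.mem_univ j) (hat_eq_zero h)

theorem latticeBump_hasCompactSupport (n : ℕ) : HasCompactSupport (latticeBump (n := n)) := by
  refine HasCompactSupport.intro (isCompact_closedBall (0 : SpaceTime n) (√(n + 1) * 1))
    fun z hz => ?_
  by_contra h
  refine hz (mem_closedBall_zero_iff.2 (norm_le_of_forall_abs_le zero_le_one fun j => ?_))
  by_contra hj
  exact h (latticeBump_eq_zero (not_le.1 hj).le)

theorem exists_bound_fderiv {n : ℕ} {f : SpaceTime n → ℝ} (hf : ContDiff ℝ ∞ f)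
    (hs : HasCompactSupport f) : ∃ C, 0 < C ∧ ∀ z, ‖fderiv ℝ f z‖ ≤ C := by
  obtain ⟨C, hC⟩ := (hs.fderiv (𝕜 := ℝ)).exists_bound_of_continuous
    (hf.continuous_fderiv (by simp))
  exact ⟨max C 1, by positivity, fun z => (hC z).trans (le_max_left _ _)⟩

/-- The lattice bump of mesh `1 / m` centred at `κ / m`. -/
def cellBump {n : ℕ} (m : ℕ) (κ : Fin (n + 1) → ℤ) (z : SpaceTime n) : ℝ :=
  latticeBump ((m : ℝ) • z - WithLp.toLp 2 fun j => (κ j : ℝ))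

theorem cellBump_contDiff {n : ℕ} (m : ℕ) (κ : Fin (n + 1) → ℤ) : ContDiff ℝ ∞ (cellBump m κ) :=
  (latticeBump_contDiff n).comp (by fun_prop)

/-- Expanding the product over coordinates of the one-dimensional sums gives the sum over lattice
points. -/
theorem sum_cellBump {n m N : ℕ} {z : SpaceTime n} (hz : ∀ j, |(m : ℝ) * z j| ≤ N) :
    ∑ κ ∈ Fintype.piFinset fun _ : Fin (n + 1) => Finset.Icc (-(N : ℤ)) N, cellBump m κ z = 1 := by
  have := Finset.prod_univ_sum (fun _ : Fin (n + 1) => Finset.Icc (-(N : ℤ)) N)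
    (fun j k => hat ((m : ℝ) * z j - k))
  rw [Finset.prod_eq_one fun j _ => sum_hat (hz j)] at this
  rw [this]
  exact Finset.sum_congr rfl fun κ _ => by simp [cellBump, latticeBump]

theorem norm_fderiv_cellBump_le {n m : ℕ} {C : ℝ}
    (hC : ∀ z, ‖fderiv ℝ (latticeBump (n := n)) z‖ ≤ C) (κ : Fin (n + 1) → ℤ) (z : SpaceTime n) :
    ‖fderiv ℝ (cellBump m κ) z‖ ≤ C * m := by
  have h1 : HasFDerivAt (fun z : SpaceTime n => (m : ℝ) • z - WithLp.toLp 2 fun j => (κ j : ℝ))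
      ((m : ℝ) • ContinuousLinearMap.id ℝ (SpaceTime n)) z :=
    ((hasFDerivAt_id z).const_smul (m : ℝ)).sub_const _
  have h2 := (((latticeBump_contDiff n).differentiable (by simp) _).hasFDerivAt.comp z h1).fderiv
  have h3 : fderiv ℝ (cellBump m κ) z = _ := h2
  rw [h3, ContinuousLinearMap.comp_smul, ContinuousLinearMap.comp_id, norm_smul, mul_comm]
  simpa using mul_le_mul_of_nonneg_right (hC _) (Nat.cast_nonneg m)

theorem cellBump_ne_zero_imp {n m : ℕ} {κ : Fin (n + 1) → ℤ} {z : SpaceTime n}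
    (h : cellBump m κ z ≠ 0) (j : Fin (n + 1)) : |(m : ℝ) * z j - κ j| ≤ 1 := by
  by_contra hj
  refine h (latticeBump_eq_zero (j := j) ?_)
  simpa using (not_le.1 hj).le

theorem tsupport_cellBump_subset {n m : ℕ} (κ : Fin (n + 1) → ℤ) :
    tsupport (cellBump (n := n) m κ) ⊆ {z | ∀ j, |(m : ℝ) * z j - κ j| ≤ 1} := by
  refine closure_minimal (fun z hz => cellBump_ne_zero_imp hz) ?_
  simp only [ofPred_forall]
  exact isClosed_iInter fun j => isClosed_le (by fun_prop) continuous_const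

/-! ### Growth on a hyperplane implies order zero. -/

/-- The contribution of a single cell to the value of a distribution of `n`-growth. -/
theorem HasGrowthOne.abs_apply_cellBump_mul_le {n m : ℕ} {T : Distr n} (hT : HasGrowthOne T)
    (hm : 0 < m) {C L M : ℝ} (hC0 : 0 < C)
    (hC : ∀ z, ‖fderiv ℝ (latticeBump (n := n)) z‖ ≤ C) (φ : Test n) (hL0 : 0 < L)
    (hL : ∀ z, ‖fderiv ℝ φ z‖ ≤ L) (κ : Fin (n + 1) → ℤ) {w : SpaceTime n}
    (hw : ∀ j, |(m : ℝ) * w j - κ j| ≤ 1) (hM : |φ w| ≤ M) :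
    |T (smulTest (cellBump m κ) (cellBump_contDiff m κ) φ)|
      ≤ (L + (M + L * (√(n + 1) * (2 / m))) * (C * m)) * (2 / m) * (2 / m) ^ n := by
  have hm' : (0 : ℝ) < m := Nat.cast_pos.2 hm
  have hM0 : 0 ≤ M := (abs_nonneg _).trans hM
  have hcell : tsupport (fun z => cellBump m κ z * φ z) ⊆ {z | ∀ j, |(m : ℝ) * z j - κ j| ≤ 1} :=
    tsupport_mul_subset_left.trans (tsupport_cellBump_subset κ)
  -- Product rule: the bump is at most `1` against `∇φ`, and its gradient, at most `C * m`, meets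
  -- `|φ|`, which on the cell exceeds `M` by at most `L` times the diameter.
  have hG : 0 < L + (M + L * (√(n + 1) * (2 / m))) * (C * m) := by positivity
  refine hT.abs_apply_le (c := WithLp.toLp 2 fun j => (κ j : ℝ) / m) (by positivity) hG _ ?_ ?_
  · refine Subset.trans hcell fun z hz j => ?_
    have : z j - (κ j : ℝ) / m = (m * z j - κ j) / m := by field_simp
    simp only [this, abs_div, abs_of_pos hm']
    rw [div_le_iff₀ hm']
    refine (hz j).trans (le_of_eq ?_)
    field_simp
  · intro z
    change ‖fderiv ℝ (fun z => cellBump m κ z * φ z) z‖ ≤ _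
    by_cases hz : z ∈ tsupport (fun z => cellBump m κ z * φ z)
    · have hzc := hcell hz
      have hzw : ‖z - w‖ ≤ √(n + 1) * (2 / m) := by
        refine norm_le_of_forall_abs_le (by positivity) fun j => ?_
        have h1 := abs_le.1 (hzc j)
        have h2 := abs_le.1 (hw j)
        have : |(m : ℝ) * (z j - w j)| ≤ 2 := abs_le.2 ⟨by linarith, by linarith⟩
        rw [abs_mul, abs_of_pos hm'] at this
        rw [PiLp.sub_apply, le_div_iff₀ hm', mul_comm]
        exact this
      have hφz : |φ z| ≤ M + L * (√(n + 1) * (2 / m)) := by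
        have h1 : ‖φ z - φ w‖ ≤ L * ‖z - w‖ :=
          convex_univ.norm_image_sub_le_of_norm_fderiv_le
            (fun x _ => φ.contDiff.differentiable (by simp) x) (fun x _ => hL x)
            (mem_univ w) (mem_univ z)
        have h2 : L * ‖z - w‖ ≤ L * (√(n + 1) * (2 / m)) := by gcongr
        have h3 : |φ z| ≤ |φ w| + |φ z - φ w| := by
          simpa using abs_add_le (φ w) (φ z - φ w)
        rw [Real.norm_eq_abs] at h1
        linarith
      rw [fderiv_fun_mul ((cellBump_contDiff m κ).differentiable (by simp) z)
        (φ.contDiff.differentiable (by simp) z)]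
      refine (norm_add_le _ _).trans (add_le_add ?_ ?_)
      · rw [norm_smul, Real.norm_eq_abs]
        calc |cellBump m κ z| * ‖fderiv ℝ φ z‖ ≤ 1 * L :=
              mul_le_mul (abs_latticeBump_le_one _) (hL z) (norm_nonneg _) zero_le_one
          _ = L := one_mul L
      · rw [norm_smul, Real.norm_eq_abs]
        exact mul_le_mul hφz (norm_fderiv_cellBump_le hC κ z) (norm_nonneg _) (by positivity)
    · rw [image_eq_zero_of_notMem_tsupport (fun h => hz (tsupport_fderiv_subset ℝ h)), norm_zero]
      exact hG.le

/-- The number of cells of mesh `1 / m` meeting a bounded piece of an affine hyperplane. -/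
theorem card_cells_le {n m R : ℕ} (hm : 0 < m) (i : Fin (n + 1)) (a : ℝ)
    (s : Finset (Fin (n + 1) → ℤ))
    (hs : ∀ κ ∈ s, ∃ w : SpaceTime n, w i = a ∧ (∀ j, |w j| ≤ R) ∧
      ∀ j, |(m : ℝ) * w j - κ j| ≤ 1) :
    s.card ≤ 3 * (m * (2 * R + 3)) ^ n := by
  -- The `i`-th index is within `1` of `m * a`, which leaves three candidates; each other index has
  -- `2 * m * R + 3 ≤ m * (2 * R + 3)`.
  have hsub : s ⊆ Fintype.piFinset fun j =>
      if j = i then Finset.Icc (⌊(m : ℝ) * a⌋ - 1) (⌊(m : ℝ) * a⌋ + 1)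
      else Finset.Icc (-((m * R + 1 : ℕ) : ℤ)) ((m * R + 1 : ℕ) : ℤ) := by
    intro κ hκ
    obtain ⟨w, hwi, hwR, hwκ⟩ := hs κ hκ
    rw [Fintype.mem_piFinset]
    intro j
    have h := abs_le.1 (hwκ j)
    split_ifs with hj
    · subst hj
      rw [hwi] at h
      have h1 := Int.floor_le ((m : ℝ) * a)
      have h2 := Int.lt_floor_add_one ((m : ℝ) * a)
      rw [Finset.mem_Icc]
      constructor
      · have : ((⌊(m : ℝ) * a⌋ - 1 : ℤ) : ℝ) ≤ κ j := by push_cast; linarith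
        exact_mod_cast this
      · have : (κ j : ℝ) < ((⌊(m : ℝ) * a⌋ + 2 : ℤ) : ℝ) := by push_cast; linarith
        have : κ j < ⌊(m : ℝ) * a⌋ + 2 := by exact_mod_cast this
        omega
    · have h1 : |(m : ℝ) * w j| ≤ m * R := by
        rw [abs_mul, Nat.abs_cast]
        exact mul_le_mul_of_nonneg_left (hwR j) (Nat.cast_nonneg m)
      have h2 := abs_le.1 h1
      rw [Finset.mem_Icc]
      constructor
      · have : ((-((m * R + 1 : ℕ) : ℤ) : ℤ) : ℝ) ≤ κ j := by push_cast; linarith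
        exact_mod_cast this
      · have : (κ j : ℝ) ≤ (((m * R + 1 : ℕ) : ℤ) : ℝ) := by push_cast; linarith
        exact_mod_cast this
  refine (Finset.card_le_card hsub).trans ?_
  rw [Fintype.card_piFinset, Fin.prod_univ_succAbove _ i]
  simp only [if_true, Fin.succAbove_ne, if_false, Int.card_Icc, Finset.prod_const,
    Finset.card_univ, Fintype.card_fin]
  refine Nat.mul_le_mul (by omega) (Nat.pow_le_pow_left ?_ n)
  have : ((m * R + 1 : ℕ) : ℤ) + 1 - -((m * R + 1 : ℕ) : ℤ) = ((2 * (m * R) + 3 : ℕ) : ℤ) := by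
    push_cast; ring
  rw [this, Int.toNat_natCast]
  nlinarith

/-- A distribution of `n`-growth supported on a bounded piece of an affine hyperplane has order
zero and only sees the values on that piece. -/
theorem HasGrowthOne.exists_abs_apply_le {n : ℕ} {E : Set (SpaceTime n)}
    (hE : Bornology.IsBounded E) {i : Fin (n + 1)} {a : ℝ} (hEa : E ⊆ {z | z i = a}) :
    ∃ K : ℝ, 0 ≤ K ∧ ∀ T : Distr n, HasGrowthOne T → Distribution.dsupport T ⊆ E →
      ∀ (φ : Test n) (M : ℝ), 0 ≤ M → (∀ z ∈ E, |φ z| ≤ M) → |T φ| ≤ K * M := by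
  obtain ⟨C, hC0, hC⟩ := exists_bound_fderiv (latticeBump_contDiff n)
    (latticeBump_hasCompactSupport n)
  obtain ⟨r, hr⟩ := hE.subset_closedBall 0
  obtain ⟨R, hR⟩ := exists_nat_ge r
  refine ⟨3 * (2 * R + 3) ^ n * 2 ^ n * (2 * C), by positivity, fun T hT hsupp φ M hM0 hM => ?_⟩
  obtain ⟨L, hL0, hL⟩ := exists_bound_fderiv φ.contDiff φ.hasCompactSupport
  obtain ⟨r', hr'⟩ := φ.hasCompactSupport.isCompact.isBounded.subset_closedBall 0
  obtain ⟨R', hR'⟩ := exists_nat_ge r'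
  -- The cell count `m ^ n` cancels against `(2 / m) ^ n`. The data of `φ` other than `M` enter only
  -- through `L`, in terms that vanish as `m → ∞`, so `K` is independent of `φ` and `T`.
  have bound : ∀ m : ℕ, 0 < m → |T φ| ≤ 3 * (2 * R + 3) ^ n * 2 ^ n *
      (2 * L / m + 2 * C * (M + L * √(n + 1) * 2 / m)) := by
    intro m hm
    have hm' : (0 : ℝ) < m := Nat.cast_pos.2 hm
    classical
    set I := Fintype.piFinset fun _ : Fin (n + 1) => Finset.Icc (-((m * R' : ℕ) : ℤ)) (m * R' : ℕ)
      with hI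
    have hsum : φ = ∑ κ ∈ I, smulTest (cellBump m κ) (cellBump_contDiff m κ) φ := by
      ext z
      have h1 : (∑ κ ∈ I, smulTest (cellBump m κ) (cellBump_contDiff m κ) φ : Test n) z
          = ∑ κ ∈ I, cellBump m κ z * φ z := by
        simp [smulTest]
      rw [h1, ← Finset.sum_mul]
      by_cases hz : z ∈ tsupport φ
      · rw [sum_cellBump, one_mul]
        intro j
        rw [abs_mul, Nat.abs_cast]
        push_cast
        refine mul_le_mul_of_nonneg_left ?_ hm'.le
        exact (abs_coord_le_norm z j).trans ((mem_closedBall_zero_iff.1 (hr' hz)).trans hR')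
      · rw [image_eq_zero_of_notMem_tsupport hz, mul_zero]
    -- Cells that miss `E` contribute nothing, which reduces the count from order `m ^ (n + 1)` to
    -- order `m ^ n`.
    set J := I.filter fun κ => T (smulTest (cellBump m κ) (cellBump_contDiff m κ) φ) ≠ 0 with hJ
    have hmeet : ∀ κ ∈ J, ∃ w ∈ E, ∀ j, |(m : ℝ) * w j - κ j| ≤ 1 := by
      intro κ hκ
      by_contra! hno
      refine (Finset.mem_filter.1 hκ).2 (apply_eq_zero_of_disjoint T _ ?_)
      refine Set.disjoint_left.2 fun z hz hzE => ?_
      obtain ⟨j, hj⟩ := hno z (hsupp hzE)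
      have : z ∈ tsupport (cellBump (n := n) m κ) := tsupport_mul_subset_left hz
      exact absurd (tsupport_cellBump_subset κ this j) (not_le.2 hj)
    have hcard : (J.card : ℝ) ≤ 3 * (m * (2 * R + 3)) ^ n := by
      have : J.card ≤ 3 * (m * (2 * R + 3)) ^ n := by
        refine card_cells_le hm i a J fun κ hκ => ?_
        obtain ⟨w, hwE, hw⟩ := hmeet κ hκ
        exact ⟨w, hEa hwE, fun j => (abs_coord_le_norm w j).trans
          ((mem_closedBall_zero_iff.1 (hr hwE)).trans hR), hw⟩
      exact_mod_cast this
    set B := (L + (M + L * (√(n + 1) * (2 / m))) * (C * m)) * (2 / m) * (2 / m : ℝ) ^ n with hB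
    calc |T φ| = |∑ κ ∈ I, T (smulTest (cellBump m κ) (cellBump_contDiff m κ) φ)| := by
          rw [← map_sum, ← hsum]
      _ = |∑ κ ∈ J, T (smulTest (cellBump m κ) (cellBump_contDiff m κ) φ)| := by
          rw [hJ, Finset.sum_filter_ne_zero]
      _ ≤ ∑ κ ∈ J, |T (smulTest (cellBump m κ) (cellBump_contDiff m κ) φ)| :=
          Finset.abs_sum_le_sum_abs _ _
      _ ≤ J.card • B := by
          refine Finset.sum_le_card_nsmul _ _ _ fun κ hκ => ?_
          obtain ⟨w, hwE, hw⟩ := hmeet κ hκ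
          exact hT.abs_apply_cellBump_mul_le hm hC0 hC φ hL0 hL κ hw (hM w hwE)
      _ ≤ 3 * (m * (2 * R + 3)) ^ n * B := by
          rw [nsmul_eq_mul]
          exact mul_le_mul_of_nonneg_right hcard (by positivity)
      _ = _ := by
          rw [hB, mul_pow, div_pow]
          field_simp
  have hlim : Filter.Tendsto (fun m : ℕ => 3 * (2 * (R : ℝ) + 3) ^ n * 2 ^ n *
      (2 * L / m + 2 * C * (M + L * √(n + 1) * 2 / m))) Filter.atTop
      (𝓝 (3 * (2 * (R : ℝ) + 3) ^ n * 2 ^ n * (0 + 2 * C * (M + 0)))) :=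
    Filter.Tendsto.const_mul _ ((tendsto_const_div_atTop_nhds_zero_nat _).add
      (Filter.Tendsto.const_mul _ (tendsto_const_nhds.add (tendsto_const_div_atTop_nhds_zero_nat _))))
  refine (ge_of_tendsto hlim ?_).trans (le_of_eq (by ring))
  filter_upwards [Filter.eventually_gt_atTop 0] with m hm using bound m hm

/-! ### Logarithmic divergence of the kernel along a spatial hyperplane. -/

theorem volume_coord_box {n : ℕ} (i : Fin (n + 1)) (I J : Set ℝ) (hI : MeasurableSet I)
    (hJ : MeasurableSet J) :
    MeasurableSet {z : SpaceTime n | ∀ j, z j ∈ if j = i then I else J} ∧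
      volume {z : SpaceTime n | ∀ j, z j ∈ if j = i then I else J} = volume I * volume J ^ n := by
  have hs : {z : SpaceTime n | ∀ j, z j ∈ if j = i then I else J}
      = WithLp.ofLp ⁻¹' (Set.univ.pi fun j => if j = i then I else J) := by
    ext z; simp
  have hm : MeasurableSet (Set.univ.pi fun j : Fin (n + 1) => if j = i then I else J) := by
    refine MeasurableSet.univ_pi fun j => ?_
    split_ifs <;> assumption
  rw [hs]
  refine ⟨(PiLp.volume_preserving_ofLp (Fin (n + 1))).measurable hm, ?_⟩
  rw [(PiLp.volume_preserving_ofLp (Fin (n + 1))).measure_preimage hm.nullMeasurableSet,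
    volume_pi_pi, Fin.prod_univ_succAbove _ i]
  simp

theorem Pstar_nonneg {n : ℕ} (z : SpaceTime n) : 0 ≤ Pstar n z := by
  unfold Pstar P
  split_ifs with h
  · exact div_nonneg h.le (by positivity)
  · exact le_rfl

theorem Pstar_le_one {n : ℕ} {z : SpaceTime n} (hz : 1 ≤ ‖z‖) : Pstar n z ≤ 1 := by
  unfold Pstar P
  split_ifs with h
  · have h1 : (-z) (Fin.last n) ≤ ‖z‖ :=
      (le_abs_self _).trans ((abs_coord_le_norm (-z) _).trans_eq (norm_neg z))
    rw [norm_neg]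
    refine div_le_one_of_le₀ (h1.trans ?_) (by positivity)
    exact le_self_pow₀ hz (by simp)
  · exact zero_le_one

/-- The kernel has infinite mass near the origin of a spatial hyperplane: its mean over a slab of
width `(1/2)^N` around it is at least a multiple of `N`. -/
theorem exists_mul_le_setIntegral_Pstar {n : ℕ} (i : Fin n) :
    ∃ c : ℝ, 0 < c ∧ ∀ (N : ℕ) (h : ℝ → ℝ), Continuous h → (∀ s, 0 ≤ h s) →
      (∀ s, |s| ≤ (1 / 2) ^ N → h s = 2 ^ N) →
      N * c ≤ ∫ v in {v : SpaceTime n | ∀ j, |v j| ≤ 1}, Pstar n v * h (-v i.castSucc) := by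
  set q : ℝ := √(n + 1) with hq
  have hq0 : 0 < q := by positivity
  -- This is the lower bound contributed by each dyadic box below: volume times kernel bound times
  -- `2 ^ N`. By homogeneity it depends neither on `k` nor on `N`.
  refine ⟨1 / 2 / q ^ (n + 1) * (1 / 2) ^ n, by positivity, fun N h hc h0 hN => ?_⟩
  have hScompact : IsCompact {v : SpaceTime n | ∀ j, |v j| ≤ 1} := by
    refine Metric.isCompact_of_isClosed_isBounded ?_ ?_
    · simp only [ofPred_forall]
      exact isClosed_iInter fun j => isClosed_le (by fun_prop) continuous_const
    · refine (Metric.isBounded_closedBall (x := (0 : SpaceTime n)) (r := q * 1)).subset fun v hv => ?_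
      exact mem_closedBall_zero_iff.2 (norm_le_of_forall_abs_le zero_le_one hv)
  have hint : IntegrableOn (fun v : SpaceTime n => Pstar n v * h (-v i.castSucc))
      {v : SpaceTime n | ∀ j, |v j| ≤ 1} volume := by
    refine ((locallyIntegrable_Pstar n).integrableOn_isCompact hScompact).mul_continuousOn ?_
      hScompact
    exact (hc.comp (by fun_prop)).continuousOn
  -- Time is negative, where `Pstar` is positive, and the `i`-th coordinate stays where `h` equals
  -- `2 ^ N`. For `k < N` that coordinate is also at most `2 ^ (-k)`, so the whole box lies at scale
  -- `2 ^ (-k)`.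
  set box : ℕ → Set (SpaceTime n) := fun k => {v | ∀ j, v j ∈ if j = i.castSucc
    then Ioc (0 : ℝ) ((1 / 2) ^ N) else Ico (-(1 / 2 : ℝ) ^ k) (-(1 / 2 : ℝ) ^ (k + 1))} with hbox
  -- Since `x_i` is spatial, time varies along the hyperplane; its dyadic ranges separate the boxes
  -- and bound the kernel below.
  have hlast : Fin.last n ≠ i.castSucc := (Fin.castSucc_lt_last i).ne'
  have hmeas : ∀ k, MeasurableSet (box k) := fun k =>
    (volume_coord_box i.castSucc _ _ measurableSet_Ioc measurableSet_Ico).1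
  have hvol : ∀ k, volume.real (box k) = (1 / 2) ^ N * ((1 / 2) ^ (k + 1)) ^ n := by
    intro k
    rw [measureReal_def, (volume_coord_box i.castSucc _ _ measurableSet_Ioc measurableSet_Ico).2,
      Real.volume_Ioc, Real.volume_Ico, ENNReal.toReal_mul, ENNReal.toReal_pow,
      ENNReal.toReal_ofReal (by simp), ENNReal.toReal_ofReal]
    · rw [pow_succ]; ring
    · rw [pow_succ]; have : (0 : ℝ) < (1 / 2) ^ k := by positivity
      linarith
  have hsmall : ∀ k < N, ∀ v ∈ box k, ∀ j, |v j| ≤ (1 / 2) ^ k := by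
    intro k hk v hv j
    have hvj := hv j
    split_ifs at hvj with hj
    · rw [abs_of_pos hvj.1]
      exact hvj.2.trans (pow_le_pow_of_le_one (by norm_num) (by norm_num) hk.le)
    · have : (0 : ℝ) < (1 / 2) ^ (k + 1) := by positivity
      rw [abs_of_neg (by linarith [hvj.2])]
      linarith [hvj.1]
  have hsub : ∀ k < N, box k ⊆ {v : SpaceTime n | ∀ j, |v j| ≤ 1} := fun k hk v hv j =>
    (hsmall k hk v hv j).trans (pow_le_one₀ (by norm_num) (by norm_num))
  have hdisj : ((Finset.range N : Finset ℕ) : Set ℕ).Pairwise (Function.onFun Disjoint box) := by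
    have key : ∀ k k', k < k' → Disjoint (box k) (box k') := by
      intro k k' hkk
      refine Set.disjoint_left.2 fun v hv hv' => ?_
      have h1 := hv (Fin.last n)
      have h2 := hv' (Fin.last n)
      rw [if_neg hlast] at h1 h2
      have : (1 / 2 : ℝ) ^ k' ≤ (1 / 2) ^ (k + 1) :=
        pow_le_pow_of_le_one (by norm_num) (by norm_num) hkk
      linarith [h1.2, h2.1]
    intro k _ k' _ hne
    rcases lt_or_gt_of_ne hne with hlt | hlt
    · exact key k k' hlt
    · exact (key k' k hlt).symm
  have hlow : ∀ k < N, ∀ v ∈ box k,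
      (1 / 2) ^ (k + 1) / (q * (1 / 2) ^ k) ^ (n + 1) * 2 ^ N ≤ Pstar n v * h (-v i.castSucc) := by
    intro k hk v hv
    have h1 := hv (Fin.last n)
    have h2 := hv i.castSucc
    rw [if_neg hlast] at h1
    rw [if_pos rfl] at h2
    have hp : (0 : ℝ) < (1 / 2) ^ (k + 1) := by positivity
    have ht : (1 / 2 : ℝ) ^ (k + 1) ≤ (-v) (Fin.last n) := by
      rw [PiLp.neg_apply]; linarith [h1.2]
    have hv0 : 0 < ‖-v‖ := hp.trans_le (ht.trans ((le_abs_self _).trans (abs_coord_le_norm _ _)))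
    have hnv : ‖-v‖ ≤ q * (1 / 2) ^ k := by
      rw [norm_neg]
      exact norm_le_of_forall_abs_le (by positivity) (hsmall k hk v hv)
    rw [hN (-v i.castSucc) (by rw [abs_neg, abs_of_pos h2.1]; exact h2.2), Pstar, P,
      if_pos (hp.trans_le ht)]
    have ht0 := hp.le.trans ht
    gcongr
  calc (N : ℝ) * (1 / 2 / q ^ (n + 1) * (1 / 2) ^ n)
      = ∑ k ∈ Finset.range N,
          volume.real (box k) * ((1 / 2) ^ (k + 1) / (q * (1 / 2) ^ k) ^ (n + 1) * 2 ^ N) := by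
        rw [Finset.sum_congr rfl (g := fun _ => 1 / 2 / q ^ (n + 1) * (1 / 2) ^ n)]
        · simp
        · intro k _
          rw [hvol]
          have h2 : (1 / 2 : ℝ) ^ N * 2 ^ N = 1 := by rw [← mul_pow]; norm_num
          generalize (1 / 2 : ℝ) ^ N = x at h2 ⊢
          generalize (2 : ℝ) ^ N = y at h2 ⊢
          rw [pow_succ (1 / 2 : ℝ) k]
          have hy : (0 : ℝ) < (1 / 2) ^ k := by positivity
          generalize (1 / 2 : ℝ) ^ k = u at hy ⊢
          have hu := hy.ne'
          rw [mul_pow, mul_pow]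
          refine Eq.trans (b := x * y * (1 / 2 / q ^ (n + 1) * (1 / 2) ^ n)) ?_ (by rw [h2, one_mul])
          field_simp
          ring
    _ ≤ ∑ k ∈ Finset.range N, ∫ v in box k, Pstar n v * h (-v i.castSucc) := by
        refine Finset.sum_le_sum fun k hk => ?_
        have hk := Finset.mem_range.1 hk
        rw [← smul_eq_mul, ← setIntegral_const]
        refine setIntegral_mono_on ?_ (hint.mono_set (hsub k hk)) (hmeas k) (hlow k hk)
        exact integrableOn_const
          ((measure_mono (hsub k hk)).trans_lt hScompact.measure_lt_top).ne
    _ = ∫ v in ⋃ k ∈ Finset.range N, box k, Pstar n v * h (-v i.castSucc) :=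
        (integral_biUnion_finset _ (fun k _ => hmeas k) hdisj
          fun k hk => hint.mono_set (hsub k (Finset.mem_range.1 hk))).symm
    _ ≤ _ := by
        refine setIntegral_mono_set hint
          (Filter.Eventually.of_forall fun v => mul_nonneg (Pstar_nonneg v) (h0 _)) ?_
        exact (iUnion₂_subset fun k hk => hsub k (Finset.mem_range.1 hk)).eventuallyLE

/-! ### Testing the potential against concentrated functions. -/

theorem PotentialBoundedByOne.abs_potential_le {n : ℕ} {T : Distr n}
    (hT : PotentialBoundedByOne T) (φ : Test n) (hφ : ∀ z, 0 ≤ φ z) :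
    |potential T φ| ≤ ∫ z, φ z := by
  obtain ⟨g, -, hg1, hg⟩ := hT
  have hint : Integrable φ volume :=
    φ.contDiff.continuous.integrable_of_hasCompactSupport φ.hasCompactSupport
  rw [hg, ← Real.norm_eq_abs]
  refine norm_integral_le_of_norm_le hint ?_
  have hae : ∀ᵐ z, ‖g z‖ₑ ≤ 1 := by
    rw [eLpNorm_exponent_top] at hg1
    filter_upwards [ae_le_eLpNormEssSup (f := g) (μ := volume)] with z hz using hz.trans hg1
  filter_upwards [hae] with z hz
  have : ‖g z‖ ≤ 1 := by
    rw [← ofReal_norm] at hz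
    exact ENNReal.ofReal_le_one.1 hz
  rw [norm_mul, Real.norm_of_nonneg (hφ z)]
  exact mul_le_of_le_one_left (hφ z) this

/-- Near `E` the test function is a function of one spatial coordinate alone, a mollified Dirac
mass of width `(1/2)^N` at `a`; its mass is bounded independently of `N`. -/
theorem exists_concentrated_test {n : ℕ} {E : Set (SpaceTime n)} (hE : Bornology.IsBounded E)
    (i : Fin (n + 1)) (a : ℝ) :
    ∃ A : ℝ, 0 ≤ A ∧ ∀ N : ℕ, ∃ (φ : Test n) (h : ℝ → ℝ), (∀ z, 0 ≤ φ z) ∧ ∫ z, φ z ≤ A ∧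
      Continuous h ∧ (∀ s, 0 ≤ h s) ∧ (∀ s, |s| ≤ (1 / 2) ^ N → h s = 2 ^ N) ∧
      ∀ z ∈ E, ∀ v : SpaceTime n, (∀ j, |v j| ≤ 1) → φ (z - v) = h (z i - v i - a) := by
  obtain ⟨r, hr⟩ := hE.subset_closedBall 0
  -- Large enough that `z - v` stays in the ball where the cutoff `θ` is `1`, for `z` in `E` and `v`
  -- in the unit box.
  set R : ℝ := max r 0 + √(n + 1) * 1 with hR
  have hR0 : 0 < R := add_pos_of_nonneg_of_pos (le_max_right _ _) (by positivity)
  let θ : ContDiffBump (0 : SpaceTime n) := ⟨R, R + 1, hR0, by linarith⟩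
  -- Height `2 ^ N` times slab thickness `4 * 2 ^ (-N)` times the cross-section of a box containing
  -- the support of `θ`.
  refine ⟨4 * (2 * (R + 1)) ^ n, by positivity, fun N => ?_⟩
  have hε : (0 : ℝ) < (1 / 2) ^ N := by positivity
  let η : ContDiffBump (0 : ℝ) := ⟨(1 / 2) ^ N, 2 * (1 / 2) ^ N, hε, by linarith⟩
  have hsm : ContDiff ℝ ∞ fun z : SpaceTime n => 2 ^ N * η (z i - a) :=
    contDiff_const.mul (η.contDiff.comp (by fun_prop))
  refine ⟨⟨fun z => (2 ^ N * η (z i - a)) * θ z, hsm.mul θ.contDiff,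
    θ.hasCompactSupport.mul_left, by simp⟩, fun s => 2 ^ N * η s, ?_, ?_, ?_, ?_, ?_, ?_⟩
  · exact fun z => mul_nonneg (mul_nonneg (by positivity) η.nonneg) θ.nonneg
  · change ∫ z : SpaceTime n, (2 ^ N * η (z i - a)) * θ z ≤ _
    set B : Set (SpaceTime n) := {z | ∀ j, z j ∈ if j = i
      then Icc (a - 2 * (1 / 2) ^ N) (a + 2 * (1 / 2) ^ N) else Icc (-(R + 1)) (R + 1)} with hB
    have hbox := volume_coord_box i (Icc (a - 2 * (1 / 2) ^ N) (a + 2 * (1 / 2) ^ N))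
      (Icc (-(R + 1)) (R + 1)) measurableSet_Icc measurableSet_Icc
    have hvol : volume B = ENNReal.ofReal (4 * (1 / 2) ^ N * (2 * (R + 1)) ^ n) := by
      rw [hbox.2, Real.volume_Icc, Real.volume_Icc, ENNReal.ofReal_mul (by positivity),
        ENNReal.ofReal_pow (by positivity)]
      congr 2
      · ring_nf
      · ring_nf
    have hle : ∀ z : SpaceTime n, (2 ^ N * η (z i - a)) * θ z ≤ B.indicator (fun _ => 2 ^ N) z := by
      intro z
      by_cases hz : z ∈ B
      · rw [indicator_of_mem hz]
        exact mul_le_of_le_one_right (by positivity) θ.le_one |>.trans'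
          (mul_le_mul_of_nonneg_right (mul_le_of_le_one_right (by positivity) η.le_one) θ.nonneg)
      · rw [indicator_of_notMem hz]
        refine le_of_eq ?_
        obtain ⟨j, hj⟩ := not_forall.1 hz
        split_ifs at hj with hji
        · subst hji
          have : η (z j - a) = 0 := by
            refine η.zero_of_le_dist ?_
            rw [dist_zero_right, Real.norm_eq_abs]
            by_contra hlt
            have := abs_le.1 (not_le.1 hlt).le
            exact hj ⟨by linarith [this.1], by linarith [this.2]⟩
          rw [this]; simp
        · have : θ z = 0 := by
            refine θ.zero_of_le_dist ?_
            rw [dist_zero_right]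
            by_contra hlt
            have := abs_le.1 ((abs_coord_le_norm z j).trans (not_le.1 hlt).le)
            exact hj ⟨this.1, this.2⟩
          rw [this, mul_zero]
    calc ∫ z : SpaceTime n, (2 ^ N * η (z i - a)) * θ z
        ≤ ∫ z, B.indicator (fun _ => (2 : ℝ) ^ N) z := by
          refine integral_mono ?_ ?_ hle
          · exact (hsm.mul θ.contDiff).continuous.integrable_of_hasCompactSupport
              θ.hasCompactSupport.mul_left
          · exact (integrable_indicator_iff hbox.1).2
              (integrableOn_const (by rw [hvol]; exact ENNReal.ofReal_ne_top))
      _ = 4 * (2 * (R + 1)) ^ n := by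
          rw [integral_indicator hbox.1, setIntegral_const, measureReal_def, hvol,
            ENNReal.toReal_ofReal (by positivity), smul_eq_mul]
          have h2 : (1 / 2 : ℝ) ^ N * 2 ^ N = 1 := by rw [← mul_pow]; norm_num
          calc _ = 4 * (2 * (R + 1)) ^ n * ((1 / 2 : ℝ) ^ N * 2 ^ N) := by ring
            _ = _ := by rw [h2, mul_one]
  · exact continuous_const.mul η.continuous
  · exact fun s => mul_nonneg (by positivity) η.nonneg
  · intro s hs
    change 2 ^ N * η s = _
    rw [η.one_of_mem_closedBall (by simpa [η] using hs), mul_one]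
  · intro z hz v hv
    change (2 ^ N * η ((z - v) i - a)) * θ (z - v) = 2 ^ N * η (z i - v i - a)
    rw [θ.one_of_mem_closedBall, mul_one, PiLp.sub_apply]
    rw [mem_closedBall_zero_iff]
    exact (norm_sub_le z v).trans (add_le_add
      ((mem_closedBall_zero_iff.1 (hr hz)).trans (le_max_left _ _))
      (norm_le_of_forall_abs_le zero_le_one hv))

/-- On a subset of a hyperplane `x_i = a`, the convolution of `P^*` with a function that depends
there only on `x_i` is constant up to the total mass of that function. -/
theorem abs_convolution_sub_le {n : ℕ} {i : Fin n} {a : ℝ} {z : SpaceTime n}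
    (hz : z i.castSucc = a) (φ : Test n) (h : ℝ → ℝ) (hφ : ∀ z, 0 ≤ φ z)
    (heq : ∀ v : SpaceTime n, (∀ j, |v j| ≤ 1) →
      φ (z - v) = h (z i.castSucc - v i.castSucc - a)) :
    |convolution (Pstar n) φ (ContinuousLinearMap.lsmul ℝ ℝ) volume z
      - ∫ v in {v : SpaceTime n | ∀ j, |v j| ≤ 1}, Pstar n v * h (-v i.castSucc)| ≤ ∫ w, φ w := by
  set S : Set (SpaceTime n) := {v | ∀ j, |v j| ≤ 1} with hS
  have hSm : MeasurableSet S := by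
    refine IsClosed.measurableSet ?_
    simp only [hS, ofPred_forall]
    exact isClosed_iInter fun j => isClosed_le (by fun_prop) continuous_const
  have hint : Integrable (fun v => Pstar n v * φ (z - v)) volume :=
    φ.hasCompactSupport.convolutionExists_right (ContinuousLinearMap.lsmul ℝ ℝ)
      (locallyIntegrable_Pstar n) φ.contDiff.continuous z
  have hintφ : Integrable (fun v => φ (z - v)) volume :=
    (φ.contDiff.continuous.integrable_of_hasCompactSupport φ.hasCompactSupport).comp_sub_left z
  -- Inside the unit box the integral no longer depends on `z`, because `z i = a` cancels; outside
  -- it `Pstar ≤ 1`, so the remainder is at most the mass of `φ`.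
  have h1 : convolution (Pstar n) φ (ContinuousLinearMap.lsmul ℝ ℝ) volume z
      = (∫ v in S, Pstar n v * φ (z - v)) + ∫ v in Sᶜ, Pstar n v * φ (z - v) :=
    (integral_add_compl hSm hint).symm
  have h2 : ∫ v in S, Pstar n v * φ (z - v) = ∫ v in S, Pstar n v * h (-v i.castSucc) := by
    refine setIntegral_congr_fun hSm fun v hv => ?_
    simp only [heq v hv, hz]
    ring_nf
  rw [h1, h2, add_sub_cancel_left, abs_of_nonneg
    (integral_nonneg fun v => mul_nonneg (Pstar_nonneg v) (hφ _))]
  calc ∫ v in Sᶜ, Pstar n v * φ (z - v) ≤ ∫ v in Sᶜ, φ (z - v) := by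
        refine setIntegral_mono_on hint.integrableOn hintφ.integrableOn hSm.compl fun v hv => ?_
        refine mul_le_of_le_one_left (hφ _) (Pstar_le_one ?_)
        obtain ⟨j, hj⟩ := not_forall.1 hv
        exact (not_le.1 hj).le.trans (abs_coord_le_norm v j)
    _ ≤ ∫ v, φ (z - v) :=
        setIntegral_le_integral hintφ (Filter.Eventually.of_forall fun v => hφ _)
    _ = ∫ w, φ w := integral_sub_left_eq_self φ volume z

/-! ### Vanishing of the total mass. -/

/-- A distribution admissible for a subset of a hyperplane `x_i = a` has zero total mass. -/
theorem Admissible.pair_one_eq_zero {n : ℕ} {E : Set (SpaceTime n)} (hE : IsCompact E) {i : Fin n}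
    {a : ℝ} (hEa : E ⊆ {z | z i.castSucc = a}) {T : Distr n} (hT : Admissible E T) :
    pair T (fun _ => 1) = 0 := by
  obtain ⟨K, hK0, hK⟩ := HasGrowthOne.exists_abs_apply_le hE.isBounded hEa
  obtain ⟨c, hc0, hc⟩ := exists_mul_le_setIntegral_Pstar i
  obtain ⟨A, hA0, hA⟩ := exists_concentrated_test hE.isBounded i.castSucc a
  have hsupp : IsCompact (Distribution.dsupport T) :=
    hE.of_isClosed_subset (Distribution.isClosed_dsupport) hT.support_subset
  -- Taken equal to `1` near all of `E`, not only near the support of `T`, since the order-zero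
  -- bound looks at values on `E`.
  obtain ⟨ψ, hψ⟩ := exists_test_eq hE (f := fun _ => 1) contDiff_const
  have hψE : ∀ z ∈ E, ψ z = 1 := fun z hz => hψ.self_of_nhdsSet z hz
  have hψT : ∀ᶠ z in 𝓝ˢ (Distribution.dsupport T), ψ z = 1 := nhdsSet_mono hT.support_subset hψ
  have hone : pair T (fun _ => 1) = T ψ := pair_eq T _ ψ hψT
  have bound : ∀ N : ℕ, |T ψ| * c * N ≤ A + K * A := by
    intro N
    obtain ⟨φ, h, hφ0, hφA, hhc, hh0, hhN, heq⟩ := hA N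
    set f := convolution (Pstar n) φ (ContinuousLinearMap.lsmul ℝ ℝ) volume with hf
    set I := ∫ v in {v : SpaceTime n | ∀ j, |v j| ≤ 1}, Pstar n v * h (-v i.castSucc) with hI
    have hNI : N * c ≤ I := hc N h hhc hh0 hhN
    have hfs : ContDiff ℝ ∞ f := contDiff_Pstar_convolution φ
    have h1 : |T (smulTest f hfs ψ)| ≤ A := by
      rw [← pair_eq T f (smulTest f hfs ψ)]
      · exact (hT.potential_le_one.abs_potential_le φ hφ0).trans hφA
      · filter_upwards [hψT] with z hz
        change f z * ψ z = f z
        rw [hz, mul_one]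
    -- On `E` this test function is `f - I`, bounded by the mass of `φ`, however large its
    -- derivatives are.
    have h2 : |T (smulTest f hfs ψ - I • ψ)| ≤ K * A := by
      refine hK T hT.growth hT.support_subset _ A hA0 fun z hz => ?_
      have : (smulTest f hfs ψ - I • ψ) z = f z - I := by
        change f z * ψ z - I * ψ z = f z - I
        rw [hψE z hz, mul_one, mul_one]
      rw [this]
      exact (abs_convolution_sub_le (hEa hz) φ h hφ0 (heq z hz)).trans hφA
    rw [map_sub, map_smul, smul_eq_mul] at h2
    have h3 : |I * T ψ| ≤ A + K * A := by
      rw [abs_le] at h1 h2 ⊢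
      constructor <;> linarith [h1.1, h1.2, h2.1, h2.2]
    have hI0 : 0 ≤ I := le_trans (by positivity) hNI
    rw [abs_mul, abs_of_nonneg hI0] at h3
    nlinarith [mul_le_mul_of_nonneg_right hNI (abs_nonneg (T ψ))]
  rw [hone]
  by_contra hne
  have hpos : 0 < |T ψ| * c := mul_pos (abs_pos.2 hne) hc0
  obtain ⟨N, hN⟩ := exists_nat_gt ((A + K * A) / (|T ψ| * c))
  rw [div_lt_iff₀ hpos] at hN
  linarith [bound N]

end HalfCaloric

end

theorem lemma6p2 (n : ℕ) (E : Set (HalfCaloric.SpaceTime n)) (hE : IsCompact E)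
    (i : Fin n) (a : ℝ) (hEa : E ⊆ {z | z i.castSucc = a}) :
    HalfCaloric.gamma E = 0 := by
  simp only [HalfCaloric.gamma, ENNReal.iSup_eq_zero]
  intro T hT
  rw [hT.pair_one_eq_zero hE hEa, abs_zero, ENNReal.ofReal_zero]
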